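/- Let $f:\mathbb{R}^n\to\mathbb{R}$ be three times continuously differentiable, bounded below by $f_{\rm low}$, with $\|\nabla^3 f(x)-\nabla^3 f(y)\|\le L\|x-y\|$ for all $x,y$ (where $L\ge 3$) and $\|\nabla^3 f(x)\|\le\kappa_3$ for all $x$. Here $\|\cdot\|$ is the Euclidean norm of vectors, and $\|T\|=\max_{\|s_1\|=\dots=\|s_p\|=1}|T[s_1,\dots,s_p]|$ for tensors; $\lambda_{\min}$ denotes the leftmost eigenvalue of a symmetric matrix. Consider Algorithm ARp-approx with $p=3$, starting point $x_0\in\mathbb{R}^n$ and parameters $\sigma_0>0$, $\theta_1,\theta_2>1$, an integer $m\ge1$, $\kappa_A,\kappa_B\ge0$ and $\kappa_C\ge1$. It generates iterates $x_k$, steps $s_k$, numbers $\sigma_k$ and $3$-tensors $T_k$ ($k\ge0$) as follows. Put $\|s_{j}\|:=1$ for $j<0$ and $\widetilde T_k:=\int_0^1\nabla^3 f(x_k+ts_k)\,dt$. At iteration $k$: 1. $T_k$ is any tensor such that, if $k\bmod m=0$, then $\|T_k-\nabla^3 f(x_k)\|\le\min\bigl(\kappa_A\sum_{i=1}^m\|s_{k-i}\|,\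 \kappa_B\bigr)$, and otherwise $\|T_k-\widetilde T_{k-1}\|\le\kappa_C\,\|T_{k-1}-\widetilde T_{k-1}\|$. 2. With $\overline T_f(x_k,s)=f(x_k)+\nabla f(x_k)[s]+\tfrac12\nabla^2f(x_k)[s]^2+\tfrac16T_k[s]^3$ and $m_k(s)=\overline T_f(x_k,s)+\tfrac{\sigma_k}{24}\|s\|^4$, the step $s_k$ is any vector such that $$m_k(s_k)-m_k(0)\le0,\qquad \|\nabla_s^1\overline T_f(x_k,s_k)\|\le\frac{\theta_1\sigma_k\|s_k\|^3}{3!},\qquad \max[0,-\lambda_{\min}(\nabla_s^2\overline T_f(x_k,s_k))]\le\frac{\theta_2\sigma_k\|s_k\|^2}{2!}.$$ 3. $x_{k+1}=x_k+s_k$ and $\sigma_{k+1}=\sigma_k+\sigma_k\|s_k\|^4$. Then there are constants $C_1,C_2$, depending only on $m,\theta_1,\theta_2,\sigma_0,\kappa_A,\kappa_B,\kappa_C,L,\kappa_3$ and on upper bounds for $f(x_0)-f_{\rm low}$, $\|\nabla f(x_0)\|$ and $\max[0,-\lambda_{\min}(\nabla^2f(x_0))]$, such that for every sequence generated by the algorithm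 and every $k\ge0$, $$\min_{1\le j\le k+1}\|\nabla f(x_j)\|\le\frac{C_1}{(k+1)^{3/4}},\qquad \min_{1\le j\le k+1}\max[0,-\lambda_{\min}(\nabla^2 f(x_j))]\le\frac{C_2}{(k+1)^{1/2}}.$$ -/

import Mathlib

open scoped Nat

namespace ARpApprox

/-- The space `ℝⁿ` with the Euclidean norm. -/
abbrev Vec (n : ℕ) : Type := EuclideanSpace ℝ (Fin n)

/-- The space of `p`-tensors on `ℝⁿ` (real `p`-linear maps), with the norm
`‖T‖ = max_{‖s₁‖ = … = ‖s_p‖ = 1} |T[s₁, …, s_p]|`. -/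
abbrev Tensor (n p : ℕ) : Type := ContinuousMultilinearMap ℝ (fun _ : Fin p => Vec n) ℝ

variable {n p : ℕ}

/-- The Hessian matrix of `f` at `x`, with entries `∇²f(x)[eᵢ, eⱼ]`. -/
noncomputable def hessianMatrix (f : Vec n → ℝ) (x : Vec n) : Matrix (Fin n) (Fin n) ℝ :=
  Matrix.of fun i j =>
    iteratedFDeriv ℝ 2 f x ![EuclideanSpace.single i (1 : ℝ), EuclideanSpace.single j (1 : ℝ)]

/-- The leftmost (real) eigenvalue of a matrix. -/
noncomputable def lambdaMin (A : Matrix (Fin n) (Fin n) ℝ) : ℝ :=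
  sInf {μ : ℝ | Module.End.HasEigenvalue (Matrix.toLin' A) μ}

/-- The magnitude of the negative curvature, `max[0, -λ_min(∇²f(x))]`. -/
noncomputable def negCurvature (f : Vec n → ℝ) (x : Vec n) : ℝ :=
  max 0 (-lambdaMin (hessianMatrix f x))

/-- The Taylor expansion of order `p` of `f` at `x` in which the `p`-th derivative
is replaced by the tensor `T`, as a function of the step `s`. -/
noncomputable def approxTaylor (f : Vec n → ℝ) (x : Vec n) (T : Tensor n p) (s : Vec n) : ℝ :=
  f x + ∑ i ∈ Finset.Icc 1 (p - 1), (1 / (i ! : ℝ)) * iteratedFDeriv ℝ i f x (fun _ => s)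
    + T (fun _ => s) / (p ! : ℝ)

/-- The regularized model. -/
noncomputable def model (f : Vec n → ℝ) (x : Vec n) (T : Tensor n p) (σ : ℝ) (s : Vec n) : ℝ :=
  approxTaylor f x T s + σ / ((p + 1)! : ℝ) * ‖s‖ ^ (p + 1)

/-- The average `∫₀¹ ∇ᵖf(x + t s) dt` of the `p`-th derivative on the segment `[x, x + s]`. -/
noncomputable def averagedTensor (p : ℕ) (f : Vec n → ℝ) (x s : Vec n) : Tensor n p :=
  ∫ t in (0 : ℝ)..1, iteratedFDeriv ℝ p f (x + t • s)

/-- The step length `‖s_j‖` for an integer index, equal to `1` by convention when `j < 0`. -/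
noncomputable def stepLength (s : ℕ → Vec n) (j : ℤ) : ℝ :=
  if j < 0 then 1 else ‖s j.toNat‖

/-- `f` is `p` times continuously differentiable, `p ≥ 2`. -/
def SmoothObjective (p : ℕ) (f : Vec n → ℝ) : Prop :=
  2 ≤ p ∧ ContDiff ℝ p f

/-- `f` is bounded below by `fLow`. -/
def BoundedBelowBy (f : Vec n → ℝ) (fLow : ℝ) : Prop :=
  ∀ x, fLow ≤ f x

/-- The `p`-th derivative of `f` is globally Lipschitz continuous with constant `L ≥ 3`. -/
def LipschitzTensor (p : ℕ) (f : Vec n → ℝ) (L : ℝ) : Prop :=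
  3 ≤ L ∧ ∀ x y, ‖iteratedFDeriv ℝ p f x - iteratedFDeriv ℝ p f y‖ ≤ L * ‖x - y‖

/-- The derivatives of orders `3, …, p - 1` are bounded below along unit directions. -/
def IntermediateBoundedBelow (p : ℕ) (f : Vec n → ℝ) : Prop :=
  ∃ κHigh : ℝ, 0 ≤ κHigh ∧ ∀ i ∈ Finset.Icc 3 (p - 1), ∀ x d : Vec n, ‖d‖ ≤ 1 →
    -κHigh ≤ iteratedFDeriv ℝ i f x (fun _ => d)

/-- If `p ≥ 3`, the `p`-th derivative of `f` is bounded by `κ`. -/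
def BoundedTensor (p : ℕ) (f : Vec n → ℝ) (κ : ℝ) : Prop :=
  3 ≤ p → ∀ x, ‖iteratedFDeriv ℝ p f x‖ ≤ κ

/-- The parameters of the algorithm. -/
structure Params where
  /-- memory length -/
  m : ℕ
  θ₁ : ℝ
  θ₂ : ℝ
  /-- initial regularization parameter -/
  σ₀ : ℝ
  κA : ℝ
  κB : ℝ
  κC : ℝ
  one_le_m : 1 ≤ m
  one_lt_θ₁ : 1 < θ₁
  one_lt_θ₂ : 1 < θ₂
  σ₀_pos : 0 < σ₀
  κA_nonneg : 0 ≤ κA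
  κB_nonneg : 0 ≤ κB
  one_le_κC : 1 ≤ κC

/-- `x`, `s`, `σ`, `T` are the iterates, steps, regularization parameters and approximate
`p`-th order tensors of a run of the adaptive `p`-th order regularization method with
parameters `P`, applied to `f` from the starting point `x₀`. -/
structure IsRun (P : Params) (f : Vec n → ℝ) (x₀ : Vec n)
    (x s : ℕ → Vec n) (σ : ℕ → ℝ) (T : ℕ → Tensor n p) : Prop where
  x_zero : x 0 = x₀
  σ_zero : σ 0 = P.σ₀
  /-- the condition on the approximate tensor when `k` is a multiple of `m` -/
  tensor_restart : ∀ k : ℕ, k % P.m = 0 →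
    ‖T k - iteratedFDeriv ℝ p f (x k)‖ ≤
      min (P.κA * ∑ i ∈ Finset.Icc 1 P.m, stepLength s ((k : ℤ) - (i : ℤ))) P.κB
  /-- the condition on the approximate tensor at the other indices `k + 1` -/
  tensor_update : ∀ k : ℕ, (k + 1) % P.m ≠ 0 →
    ‖T (k + 1) - averagedTensor p f (x k) (s k)‖ ≤
      P.κC * ‖T k - averagedTensor p f (x k) (s k)‖
  step_decrease : ∀ k,
    model f (x k) (T k) (σ k) (s k) - model f (x k) (T k) (σ k) 0 ≤ 0
  step_gradient : ∀ k,
    ‖gradient (approxTaylor f (x k) (T k)) (s k)‖ ≤ P.θ₁ * σ k * ‖s k‖ ^ p / (p ! : ℝ)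
  step_curvature : ∀ k,
    negCurvature (approxTaylor f (x k) (T k)) (s k) ≤
      P.θ₂ * σ k * ‖s k‖ ^ (p - 1) / ((p - 1)! : ℝ)
  x_succ : ∀ k, x (k + 1) = x k + s k
  σ_succ : ∀ k, σ (k + 1) = σ k + σ k * ‖s k‖ ^ (p + 1)

/-- `min_{1 ≤ j ≤ k + 1} a_j`. -/
noncomputable def minUpTo (a : ℕ → ℝ) (k : ℕ) : ℝ :=
  (Finset.Icc 1 (k + 1)).inf' (Finset.nonempty_Icc.mpr (Nat.le_add_left 1 k)) a

end ARpApprox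

/-!
The averaged tensor of a step differs from the `p`-th derivative at either endpoint by at most
`L` times the step length. Between restarts the tensor error therefore grows only by the factor
`κC` and by multiples of the last step length, so it is at most a constant `E` times the sum
`W_k` of the last `2m + 1` step lengths. Taylor's formula then bounds the gradient and the negative
curvature at `x_{k+1}` by `(θ σ_k + E) W_k ^ p` and `(θ σ_k + E) W_k ^ (p - 1)`.

Since `∑ ‖s_j‖ ^ (p + 1) ≤ σ_k / σ₀`, the rates follow from a bound on `σ_k`: some `W_j` with
`j ≤ k` is then of order `(k + 1) ^ (-1 / (p + 1))`. For this bound, each step decreases `f` by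
a multiple of `σ_k ‖s_k‖ ^ (p + 1)`, up to `E W_k ^ (p + 1)`. Once `σ_k` exceeds a threshold, half
of its increase pays for these errors. While `σ_k` is below the threshold, all earlier steps and
hence all windows are bounded, so gradient, negative curvature and tensor error are bounded, and
therefore the step `s_k` that crosses the threshold is bounded too.
-/

namespace ARpApprox

section Eigenvalues

open Matrix

variable {n : ℕ} {A : Matrix (Fin n) (Fin n) ℝ}

theorem lambdaMin_eq_sInf_spectrum (A : Matrix (Fin n) (Fin n) ℝ) :
    lambdaMin A = sInf (spectrum ℝ A) := by
  simp only [lambdaMin, Module.End.hasEigenvalue_iff_mem_spectrum, Matrix.spectrum_toLin',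
    Set.ofPred_mem_eq]

theorem lambdaMin_le_of_mem_spectrum {μ : ℝ} (hμ : μ ∈ spectrum ℝ A) : lambdaMin A ≤ μ := by
  rw [lambdaMin_eq_sInf_spectrum]
  exact csInf_le (Matrix.finite_spectrum A).bddBelow hμ

theorem hasEigenvalue_lambdaMin [NeZero n] (hA : A.IsHermitian) :
    Module.End.HasEigenvalue (toLin' A) (lambdaMin A) := by
  have hne : (spectrum ℝ A).Nonempty := ⟨_, hA.eigenvalues_mem_spectrum_real 0⟩
  rw [Module.End.hasEigenvalue_iff_mem_spectrum, spectrum_toLin', lambdaMin_eq_sInf_spectrum]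
  exact hne.csInf_mem (Matrix.finite_spectrum A)

theorem lambdaMin_mul_dotProduct_self_le (hA : A.IsHermitian) (v : Fin n → ℝ) :
    lambdaMin A * (v ⬝ᵥ v) ≤ v ⬝ᵥ (A *ᵥ v) := by
  have hpos : (A - algebraMap ℝ _ (lambdaMin A)).PosSemidef := by
    refine posSemidef_iff_isHermitian_and_spectrum_nonneg.2 ⟨hA.sub ?_, ?_⟩
    · rw [algebraMap_eq_diagonal]
      exact isHermitian_diagonal _
    · rw [← spectrum.sub_singleton_eq, Set.sub_singleton]
      rintro _ ⟨μ, hμ, rfl⟩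
      exact sub_nonneg.2 (lambdaMin_le_of_mem_spectrum hμ)
  have h := hpos.dotProduct_mulVec_nonneg v
  simp only [Algebra.algebraMap_eq_smul_one, star_trivial, sub_mulVec, smul_mulVec, one_mulVec,
    dotProduct_sub, dotProduct_smul, smul_eq_mul] at h
  linarith

theorem exists_dotProduct_mulVec_eq_lambdaMin_mul [NeZero n] (hA : A.IsHermitian) :
    ∃ v : Fin n → ℝ, v ≠ 0 ∧ v ⬝ᵥ (A *ᵥ v) = lambdaMin A * (v ⬝ᵥ v) := by
  obtain ⟨v, hv⟩ := (hasEigenvalue_lambdaMin hA).exists_hasEigenvector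
  refine ⟨v, hv.2, ?_⟩
  rw [← toLin'_apply, hv.apply_eq_smul, dotProduct_smul, smul_eq_mul]

end Eigenvalues

section NegativeCurvature

open Matrix

variable {n : ℕ} {f g : Vec n → ℝ}

theorem ofLp_dotProduct_self (v : Vec n) : v.ofLp ⬝ᵥ v.ofLp = ‖v‖ ^ 2 := by
  rw [EuclideanSpace.real_norm_sq_eq]
  simp only [dotProduct, sq]

theorem dotProduct_hessianMatrix_mulVec (f : Vec n → ℝ) (x v : Vec n) :
    v.ofLp ⬝ᵥ (hessianMatrix f x *ᵥ v.ofLp) = iteratedFDeriv ℝ 2 f x (fun _ => v) := by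
  have hv : v = ∑ i, v i • EuclideanSpace.single i (1 : ℝ) := by
    ext j
    simp [Finset.sum_apply, Pi.single_apply]
  rw [iteratedFDeriv_two_apply]
  conv_rhs => rw [hv]
  simp only [map_sum, map_smul, _root_.sum_apply, _root_.smul_apply,
    dotProduct, mulVec, hessianMatrix, of_apply, iteratedFDeriv_two_apply, smul_eq_mul,
    Finset.mul_sum]
  rw [Finset.sum_comm]
  refine Finset.sum_congr rfl fun i _ => Finset.sum_congr rfl fun j _ => ?_
  simp only [cons_val_zero, cons_val_one]
  ring

theorem isHermitian_hessianMatrix (hf : ContDiff ℝ 2 f) (x : Vec n) :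
    (hessianMatrix f x).IsHermitian := by
  ext i j
  simp only [hessianMatrix, conjTranspose_apply, of_apply, star_trivial, iteratedFDeriv_two_apply]
  exact (hf.contDiffAt.isSymmSndFDerivAt (by simp)) _ _

theorem negCurvature_nonneg (f : Vec n → ℝ) (x : Vec n) : 0 ≤ negCurvature f x :=
  le_max_left _ _

theorem neg_iteratedFDeriv_two_le (hf : ContDiff ℝ 2 f) (x v : Vec n) :
    -iteratedFDeriv ℝ 2 f x (fun _ => v) ≤ negCurvature f x * ‖v‖ ^ 2 := by
  have hquad := lambdaMin_mul_dotProduct_self_le (isHermitian_hessianMatrix hf x) v.ofLp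
  rw [dotProduct_hessianMatrix_mulVec, ofLp_dotProduct_self] at hquad
  calc -iteratedFDeriv ℝ 2 f x (fun _ => v)
      ≤ -lambdaMin (hessianMatrix f x) * ‖v‖ ^ 2 := by linarith
    _ ≤ negCurvature f x * ‖v‖ ^ 2 := by gcongr; exact le_max_right _ _

theorem negCurvature_le (hf : ContDiff ℝ 2 f) (x : Vec n) {c : ℝ} (hc : 0 ≤ c)
    (h : ∀ v, -iteratedFDeriv ℝ 2 f x (fun _ => v) ≤ c * ‖v‖ ^ 2) : negCurvature f x ≤ c := by
  refine max_le hc ?_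
  rcases Nat.eq_zero_or_pos n with rfl | hn
  · rwa [lambdaMin_eq_sInf_spectrum, spectrum.of_subsingleton, Real.sInf_empty, neg_zero]
  · have : NeZero n := ⟨hn.ne'⟩
    obtain ⟨v, hv, hveq⟩ :=
      exists_dotProduct_mulVec_eq_lambdaMin_mul (isHermitian_hessianMatrix hf x)
    have hle := h (WithLp.toLp 2 v)
    rw [← dotProduct_hessianMatrix_mulVec, hveq, ofLp_dotProduct_self, ← neg_mul] at hle
    refine le_of_mul_le_mul_right hle ?_
    have : WithLp.toLp 2 v ≠ 0 := by simpa using hv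
    positivity

theorem negCurvature_le_add_norm (hf : ContDiff ℝ 2 f) (hg : ContDiff ℝ 2 g) (x y : Vec n) :
    negCurvature f x ≤
      negCurvature g y + ‖iteratedFDeriv ℝ 2 f x - iteratedFDeriv ℝ 2 g y‖ := by
  refine negCurvature_le hf x (add_nonneg (negCurvature_nonneg _ _) (norm_nonneg _)) fun v => ?_
  have hcurv := neg_iteratedFDeriv_two_le hg y v
  have hdiff := (iteratedFDeriv ℝ 2 f x - iteratedFDeriv ℝ 2 g y).le_opNorm (fun _ => v)
  simp only [_root_.sub_apply, Finset.prod_const, Finset.card_univ, Fintype.card_fin] at hdiff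
  linarith [(abs_le.1 hdiff).1]

end NegativeCurvature

section Symmetry

variable {E F : Type*} [NormedAddCommGroup E] [NormedSpace ℝ E] [NormedAddCommGroup F]
  [NormedSpace ℝ F] {f : E → F}

theorem iteratedFDeriv_add_two_apply (f : E → F) {p : ℕ} (x : E) (v : Fin (p + 2) → E) :
    iteratedFDeriv ℝ (p + 2) f x v =
      fderiv ℝ (fderiv ℝ (iteratedFDeriv ℝ p f)) x (v 0) (v 1) (Fin.tail (Fin.tail v)) := by
  have hcurry := LinearIsometryEquiv.comp_fderiv (𝕜 := ℝ) (F := E [×p + 1]→L[ℝ] F)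
    (continuousMultilinearCurryLeftEquiv ℝ (fun _ : Fin (p + 1) => E) F).symm
    (f := fderiv ℝ (iteratedFDeriv ℝ p f)) (x := x)
  rw [iteratedFDeriv_succ_apply_left, iteratedFDeriv_succ_eq_comp_left]
  exact congrArg (fun B => B (v 0) (Fin.tail v)) hcurry

-- Over `ℝ`, Mathlib's `ContDiffAt.iteratedFDeriv_comp_perm` assumes analyticity.
theorem iteratedFDeriv_comp_swap {p : ℕ} (hf : ContDiff ℝ (p + 1 : ℕ) f) (x : E)
    (v : Fin (p + 1) → E) (i : Fin p) :
    iteratedFDeriv ℝ (p + 1) f x (v ∘ Equiv.swap i.castSucc i.succ) =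
      iteratedFDeriv ℝ (p + 1) f x v := by
  induction p generalizing x with
  | zero => exact i.elim0
  | succ p ih =>
    cases i using Fin.cases with
    | zero =>
      have hsymm : IsSymmSndFDerivAt ℝ (iteratedFDeriv ℝ p f) x :=
        (hf.iteratedFDeriv_right (m := 2) (i := p)
          (by norm_cast; omega)).contDiffAt.isSymmSndFDerivAt (by simp)
      have htail : Fin.tail (Fin.tail (v ∘ Equiv.swap 0 1)) = Fin.tail (Fin.tail v) := by
        ext i
        simp only [Fin.tail, Function.comp_apply]
        rw [Equiv.swap_apply_of_ne_of_ne (Fin.succ_ne_zero _) (Fin.succ_succ_ne_one _)]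
      simp only [Fin.castSucc_zero, Fin.succ_zero_eq_one, iteratedFDeriv_add_two_apply, htail,
        Function.comp_apply, Equiv.swap_apply_left, Equiv.swap_apply_right]
      rw [hsymm (v 1) (v 0)]
    | succ j =>
      have hd : Differentiable ℝ (iteratedFDeriv ℝ (p + 1) f) :=
        hf.differentiable_iteratedFDeriv (by norm_cast; omega)
      have htail : Fin.tail (v ∘ Equiv.swap j.succ.castSucc j.succ.succ) =
          Fin.tail v ∘ Equiv.swap j.castSucc j.succ := by
        ext i
        simp only [Fin.tail, Function.comp_apply, ← Fin.succ_castSucc]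
        rw [(Fin.succ_injective _).swap_apply]
      have hzero : (v ∘ Equiv.swap j.succ.castSucc j.succ.succ) 0 = v 0 :=
        congrArg v (Equiv.swap_apply_of_ne_of_ne
          (Fin.succ_castSucc j ▸ (Fin.succ_ne_zero _).symm) (Fin.succ_ne_zero _).symm)
      rw [(hd x).iteratedFDeriv_succ_apply_left', (hd x).iteratedFDeriv_succ_apply_left', htail,
        hzero]
      simp only [ih (hf.of_le (by norm_cast; omega))]

theorem iteratedFDeriv_comp_perm {p : ℕ} (hf : ContDiff ℝ p f) (x : E) (v : Fin p → E)
    (σ : Equiv.Perm (Fin p)) : iteratedFDeriv ℝ p f x (v ∘ σ) = iteratedFDeriv ℝ p f x v := by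
  cases p with
  | zero => rw [Subsingleton.elim (v ∘ σ) v]
  | succ p =>
    induction σ using Submonoid.induction_of_closure_eq_top_right
      (Equiv.Perm.mclosure_swap_castSucc_succ p) with
    | one => rfl
    | mul_right σ τ hτ ih =>
      obtain ⟨i, rfl⟩ := hτ
      rw [Equiv.Perm.coe_mul, ← Function.comp_assoc, iteratedFDeriv_comp_swap hf, ih]

end Symmetry

section Diagonal

variable {E F : Type*} [NormedAddCommGroup E] [NormedSpace ℝ E] [NormedAddCommGroup F]
  [NormedSpace ℝ F]

theorem iteratedFDeriv_eq_zero_of_map_two_smul {f : E → F} {q i : ℕ} (hf : ContDiff ℝ i f)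
    (hq : ∀ y, f ((2 : ℝ) • y) = (2 : ℝ) ^ q • f y) (hi : i ≠ q) :
    iteratedFDeriv ℝ i f 0 = 0 := by
  have hcomp := ((2 : ℝ) • ContinuousLinearMap.id ℝ E).iteratedFDeriv_comp_right hf 0 le_rfl
  have hscale : f ∘ ((2 : ℝ) • ContinuousLinearMap.id ℝ E) = (2 : ℝ) ^ q • f := by
    ext y
    simp [hq]
  rw [hscale, iteratedFDeriv_const_smul_apply hf.contDiffAt] at hcomp
  ext v
  have hv : (2 : ℝ) ^ q • iteratedFDeriv ℝ i f 0 v = (2 : ℝ) ^ i • iteratedFDeriv ℝ i f 0 v := by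
    simpa [ContinuousMultilinearMap.map_smul_univ _ (fun _ => (2 : ℝ))]
      using congrArg (fun A => A v) hcomp
  rw [← sub_eq_zero, ← sub_smul, smul_eq_zero, sub_eq_zero] at hv
  exact hv.resolve_left fun h => hi (pow_right_injective₀ (by norm_num) (by norm_num) h).symm

variable {q : ℕ} (A : ContinuousMultilinearMap ℝ (fun _ : Fin q => E) F)

theorem contDiff_diagonal {m : WithTop ℕ∞} : ContDiff ℝ m (fun y => A (fun _ => y)) :=
  A.contDiff.comp (contDiff_pi.2 fun _ => contDiff_id)

theorem iteratedFDeriv_diagonal_zero_of_ne {i : ℕ} (hi : i ≠ q) :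
    iteratedFDeriv ℝ i (fun y => A (fun _ => y)) 0 = 0 := by
  refine iteratedFDeriv_eq_zero_of_map_two_smul (contDiff_diagonal A) (fun y => ?_) hi
  simpa using A.map_smul_univ (fun _ => (2 : ℝ)) (fun _ => y)

theorem iteratedFDeriv_diagonal_of_lt {i : ℕ} (hi : q < i) (y : E) :
    iteratedFDeriv ℝ i (fun y => A (fun _ => y)) y = 0 := by
  induction i, hi using Nat.le_induction generalizing y with
  | base =>
    have hconst : iteratedFDeriv ℝ q (fun y => A (fun _ => y)) =
        fun _ => iteratedFDeriv ℝ q (fun y => A (fun _ => y)) 0 := by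
      ext y v
      rw [A.iteratedFDeriv_comp_diagonal, A.iteratedFDeriv_comp_diagonal]
    ext v
    rw [iteratedFDeriv_succ_apply_left, hconst, fderiv_fun_const]
    rfl
  | succ i _ ih =>
    ext v
    rw [iteratedFDeriv_succ_apply_left, funext ih, fderiv_fun_const]
    rfl

theorem iteratedFDeriv_diagonal_iteratedFDeriv {f : E → F} (hf : ContDiff ℝ q f) (x y : E) :
    iteratedFDeriv ℝ q (fun s => iteratedFDeriv ℝ q f x (fun _ => s)) y =
      (q ! : ℝ) • iteratedFDeriv ℝ q f x := by
  ext v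
  rw [ContinuousMultilinearMap.iteratedFDeriv_comp_diagonal]
  change ∑ σ : Equiv.Perm (Fin q), iteratedFDeriv ℝ q f x (v ∘ σ) = _
  rw [Finset.sum_congr rfl fun σ _ => iteratedFDeriv_comp_perm hf x v σ]
  simp [Fintype.card_perm, ← Nat.cast_smul_eq_nsmul ℝ]

theorem iteratedFDeriv_diagonal_sub (B : ContinuousMultilinearMap ℝ (fun _ : Fin q => E) F)
    (y : E) : iteratedFDeriv ℝ q (fun s => (A - B) (fun _ => s)) y =
      iteratedFDeriv ℝ q (fun s => A (fun _ => s)) y -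
        iteratedFDeriv ℝ q (fun s => B (fun _ => s)) y := by
  ext v
  rw [_root_.sub_apply, (A - B).iteratedFDeriv_comp_diagonal, A.iteratedFDeriv_comp_diagonal,
    B.iteratedFDeriv_comp_diagonal, ← Finset.sum_sub_distrib]
  rfl

theorem norm_iteratedFDeriv_diagonal_le (y : E) :
    ‖iteratedFDeriv ℝ q (fun s => A (fun _ => s)) y‖ ≤ q ! * ‖A‖ := by
  refine ContinuousMultilinearMap.opNorm_le_bound (by positivity) fun v => ?_
  have hperm : ∀ σ : Equiv.Perm (Fin q), ‖A fun i => v (σ i)‖ ≤ ‖A‖ * ∏ i, ‖v i‖ := fun σ =>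
    (A.le_opNorm _).trans_eq (by rw [Equiv.prod_comp σ (‖v ·‖)])
  rw [A.iteratedFDeriv_comp_diagonal, mul_assoc]
  simpa [Fintype.card_perm] using norm_sum_le_of_le Finset.univ fun σ _ => hperm σ

theorem neg_mul_norm_pow_le_apply_diagonal {B : ContinuousMultilinearMap ℝ (fun _ : Fin q => E) ℝ}
    {κ : ℝ} (hB : ∀ d : E, ‖d‖ ≤ 1 → -κ ≤ B (fun _ => d)) (y : E) :
    -κ * ‖y‖ ^ q ≤ B (fun _ => y) := by
  have hy : ‖y‖ • ‖y‖⁻¹ • y = y := by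
    rcases eq_or_ne y 0 with rfl | hy
    · simp
    · rw [smul_inv_smul₀ (norm_ne_zero_iff.2 hy)]
  have hunit : ‖‖y‖⁻¹ • y‖ ≤ 1 := by
    rw [norm_smul, norm_inv, norm_norm]
    exact inv_mul_le_one
  calc -κ * ‖y‖ ^ q ≤ B (fun _ => ‖y‖⁻¹ • y) * ‖y‖ ^ q := by gcongr; exact hB _ hunit
    _ = B (fun _ => ‖y‖ • ‖y‖⁻¹ • y) := by
      rw [B.map_smul_univ (fun _ => ‖y‖), Finset.prod_const, Finset.card_univ, Fintype.card_fin,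
        smul_eq_mul, mul_comm]
    _ = B (fun _ => y) := by rw [hy]

end Diagonal

section MeanValue

variable {E F : Type*} [NormedAddCommGroup E] [NormedSpace ℝ E] [NormedAddCommGroup F]
  [NormedSpace ℝ F] {f : E → F} {r C : ℝ} {i : ℕ} {y : E}

theorem norm_iteratedFDeriv_le_of_norm_succ_le (hf : ContDiff ℝ (i + 1 : ℕ) f)
    (h0 : iteratedFDeriv ℝ i f 0 = 0)
    (hC : ∀ z, ‖z‖ ≤ r → ‖iteratedFDeriv ℝ (i + 1) f z‖ ≤ C) (hy : ‖y‖ ≤ r) :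
    ‖iteratedFDeriv ℝ i f y‖ ≤ C * r := by
  have hC0 : 0 ≤ C := (norm_nonneg _).trans (hC y hy)
  have hmean := (convex_closedBall (0 : E) r).norm_image_sub_le_of_norm_fderiv_le
    (f := iteratedFDeriv ℝ i f) (𝕜 := ℝ) (C := C) (x := 0) (y := y)
    (fun z _ => hf.differentiable_iteratedFDeriv (by exact_mod_cast Nat.lt_succ_self i) z)
    (fun z hz => by
      rw [norm_fderiv_iteratedFDeriv]
      exact hC z (by simpa using hz))
    (by simpa using (norm_nonneg y).trans hy) (by simpa using hy)
  rw [h0, sub_zero, sub_zero] at hmean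
  exact hmean.trans (mul_le_mul_of_nonneg_left hy hC0)

theorem norm_iteratedFDeriv_le_mul_pow {p : ℕ} (hf : ContDiff ℝ p f)
    (h0 : ∀ j < p, iteratedFDeriv ℝ j f 0 = 0)
    (hC : ∀ z, ‖z‖ ≤ r → ‖iteratedFDeriv ℝ p f z‖ ≤ C) (hi : i ≤ p) (hy : ‖y‖ ≤ r) :
    ‖iteratedFDeriv ℝ i f y‖ ≤ C * r ^ (p - i) := by
  induction hi using Nat.decreasingInduction generalizing y with
  | self => simpa using hC y hy
  | of_succ j hj ih =>
    rw [show p - j = p - (j + 1) + 1 by omega, pow_succ, ← mul_assoc]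
    exact norm_iteratedFDeriv_le_of_norm_succ_le (hf.of_le (by exact_mod_cast hj)) (h0 j hj)
      (fun z hz => ih hz) hy

end MeanValue

section ApproxTaylor

variable {n p : ℕ} {f : Vec n → ℝ} {x : Vec n} {T : Tensor n p}

theorem approxTaylor_eq_sum_range (hp : p ≠ 0) (f : Vec n → ℝ) (x : Vec n) (T : Tensor n p) :
    approxTaylor f x T = fun s =>
      ∑ j ∈ Finset.range p, (j ! : ℝ)⁻¹ • iteratedFDeriv ℝ j f x (fun _ => s) +
        (p ! : ℝ)⁻¹ • T (fun _ => s) := by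
  have hIcc : Finset.Icc 1 (p - 1) = Finset.Ico 1 p :=
    Finset.Icc_sub_one_right_eq_Ico_of_not_isMin (mt isMin_iff_eq_bot.1 hp) 1
  ext s
  rw [Finset.range_eq_Ico, Finset.sum_eq_sum_Ico_succ_bot (Nat.pos_of_ne_zero hp), approxTaylor,
    hIcc, iteratedFDeriv_zero_apply, Nat.factorial_zero, Nat.cast_one, inv_one, one_smul]
  simp only [smul_eq_mul, div_eq_inv_mul, mul_one, zero_add]

theorem contDiff_approxTaylor (f : Vec n → ℝ) (x : Vec n) (T : Tensor n p) {m : WithTop ℕ∞} :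
    ContDiff ℝ m (approxTaylor f x T) :=
  (contDiff_const.add (ContDiff.sum fun i _ =>
    contDiff_const.mul (contDiff_diagonal (iteratedFDeriv ℝ i f x)))).add
      ((contDiff_diagonal T).div_const _)

theorem approxTaylor_zero (hp : p ≠ 0) (f : Vec n → ℝ) (x : Vec n) (T : Tensor n p) :
    approxTaylor f x T 0 = f x := by
  have hzero : ∀ {q : ℕ}, q ≠ 0 → ∀ A : Tensor n q, A (fun _ => 0) = 0 := fun hq A => by
    have := NeZero.mk hq
    exact A.map_zero
  rw [approxTaylor, hzero hp, Finset.sum_eq_zero fun i hi => by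
    rw [hzero (Nat.one_le_iff_ne_zero.1 (Finset.mem_Icc.1 hi).1), mul_zero]]
  simp

theorem iteratedFDeriv_approxTaylor (hp : p ≠ 0) (f : Vec n → ℝ) (x : Vec n) (T : Tensor n p)
    (i : ℕ) (y : Vec n) :
    iteratedFDeriv ℝ i (approxTaylor f x T) y =
      ∑ j ∈ Finset.range p,
          (j ! : ℝ)⁻¹ • iteratedFDeriv ℝ i (fun s => iteratedFDeriv ℝ j f x (fun _ => s)) y +
        (p ! : ℝ)⁻¹ • iteratedFDeriv ℝ i (fun s => T (fun _ => s)) y := by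
  have hterm : ∀ (c : ℝ) {q : ℕ} (A : Tensor n q),
      ContDiffAt ℝ i (fun s => c • A (fun _ => s)) y := fun c q A =>
    ((contDiff_diagonal A).const_smul c).contDiffAt
  rw [approxTaylor_eq_sum_range hp, fun_iteratedFDeriv_add_apply
    (ContDiffAt.sum fun j _ => hterm _ _) (hterm _ _), iteratedFDeriv_fun_sum_apply
      fun j _ => hterm _ _]
  simp only [iteratedFDeriv_const_smul_apply' (contDiff_diagonal _).contDiffAt]

theorem iteratedFDeriv_approxTaylor_zero (hf : ContDiff ℝ p f) {i : ℕ} (hi : i < p) :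
    iteratedFDeriv ℝ i (approxTaylor f x T) 0 = iteratedFDeriv ℝ i f x := by
  rw [iteratedFDeriv_approxTaylor (by omega), iteratedFDeriv_diagonal_zero_of_ne T hi.ne,
    Finset.sum_eq_single_of_mem i (Finset.mem_range.2 hi) fun j _ hj => by
      rw [iteratedFDeriv_diagonal_zero_of_ne _ hj.symm, smul_zero],
    iteratedFDeriv_diagonal_iteratedFDeriv (hf.of_le (by exact_mod_cast hi.le)),
    inv_smul_smul₀ (by positivity), smul_zero, add_zero]

theorem iteratedFDeriv_approxTaylor_self (hp : p ≠ 0) (f : Vec n → ℝ) (x : Vec n)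
    (T : Tensor n p) (y : Vec n) :
    iteratedFDeriv ℝ p (approxTaylor f x T) y =
      (p ! : ℝ)⁻¹ • iteratedFDeriv ℝ p (fun s => T (fun _ => s)) y := by
  rw [iteratedFDeriv_approxTaylor hp, Finset.sum_eq_zero fun j hj => by
    rw [iteratedFDeriv_diagonal_of_lt _ (Finset.mem_range.1 hj), smul_zero], zero_add]

theorem norm_iteratedFDeriv_sub_approxTaylor_le (hp : p ≠ 0) (hf : ContDiff ℝ p f)
    (x y z : Vec n) (T : Tensor n p) :
    ‖iteratedFDeriv ℝ p f z - iteratedFDeriv ℝ p (approxTaylor f x T) y‖ ≤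
      ‖iteratedFDeriv ℝ p f z - T‖ := by
  have hfact : (p ! : ℝ) ≠ 0 := by positivity
  have hsymm : iteratedFDeriv ℝ p f z - iteratedFDeriv ℝ p (approxTaylor f x T) y =
      (p ! : ℝ)⁻¹ • iteratedFDeriv ℝ p (fun s => (iteratedFDeriv ℝ p f z - T) (fun _ => s)) y := by
    rw [iteratedFDeriv_approxTaylor_self hp, iteratedFDeriv_diagonal_sub,
      iteratedFDeriv_diagonal_iteratedFDeriv hf, smul_sub, inv_smul_smul₀ hfact]
  rw [hsymm, norm_smul, norm_inv, Real.norm_natCast, inv_mul_le_iff₀ (by positivity)]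
  exact norm_iteratedFDeriv_diagonal_le _ _

open scoped NNReal in
theorem norm_iteratedFDeriv_add_sub_approxTaylor_le (hf : ContDiff ℝ p f) (hp : p ≠ 0) {L : ℝ≥0}
    (hL : LipschitzWith L (iteratedFDeriv ℝ p f)) (x s : Vec n) (T : Tensor n p) {i : ℕ}
    (hi : i ≤ p) :
    ‖iteratedFDeriv ℝ i f (x + s) - iteratedFDeriv ℝ i (approxTaylor f x T) s‖ ≤
      (‖T - iteratedFDeriv ℝ p f x‖ + L * ‖s‖) * ‖s‖ ^ (p - i) := by
  have hshift : ContDiff ℝ p (fun y => f (x + y)) := hf.comp (contDiff_const.add contDiff_id)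
  have herror : ∀ j ≤ p, ∀ y, iteratedFDeriv ℝ j (fun y => f (x + y) - approxTaylor f x T y) y =
      iteratedFDeriv ℝ j f (x + y) - iteratedFDeriv ℝ j (approxTaylor f x T) y := fun j hj y => by
    rw [← iteratedFDeriv_comp_add_left]
    exact fun_iteratedFDeriv_sub_apply (hshift.of_le (by exact_mod_cast hj)).contDiffAt
      (contDiff_approxTaylor f x T).contDiffAt
  rw [← herror i hi]
  refine norm_iteratedFDeriv_le_mul_pow (hshift.sub (contDiff_approxTaylor f x T))
    (fun j hj => ?_) (fun y hy => ?_) hi le_rfl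
  · rw [herror j hj.le, iteratedFDeriv_approxTaylor_zero hf hj, add_zero, sub_self]
  · rw [herror p le_rfl]
    have hlip := hL.norm_sub_le (x + y) x
    rw [add_sub_cancel_left] at hlip
    calc _ ≤ ‖iteratedFDeriv ℝ p f (x + y) - T‖ :=
          norm_iteratedFDeriv_sub_approxTaylor_le hp hf _ _ _ _
      _ ≤ ‖iteratedFDeriv ℝ p f (x + y) - iteratedFDeriv ℝ p f x‖ +
            ‖iteratedFDeriv ℝ p f x - T‖ := norm_sub_le_norm_sub_add_norm_sub _ _ _
      _ ≤ ‖T - iteratedFDeriv ℝ p f x‖ + L * ‖s‖ := by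
        rw [norm_sub_rev _ T, add_comm]
        gcongr
        exact hlip.trans (by gcongr)

end ApproxTaylor

section Window

/-- The sum of the `N` consecutive terms of `ℓ` ending with `ℓ j`, by which the past step lengths
enter the accuracy of the approximate tensors. -/
noncomputable def windowSum (N : ℕ) (ℓ : ℤ → ℝ) (j : ℤ) : ℝ :=
  ∑ i ∈ Finset.range N, ℓ (j - i)

variable {N : ℕ} {ℓ : ℤ → ℝ}

theorem windowSum_nonneg (hℓ : ∀ j, 0 ≤ ℓ j) (j : ℤ) : 0 ≤ windowSum N ℓ j :=
  Finset.sum_nonneg fun _ _ => hℓ _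

theorem windowSum_succ (N : ℕ) (ℓ : ℤ → ℝ) (j : ℤ) :
    windowSum (N + 1) ℓ j = windowSum N ℓ (j - 1) + ℓ j := by
  rw [windowSum, Finset.sum_range_succ', windowSum]
  simp only [Nat.cast_add, Nat.cast_one, sub_sub, add_comm, Nat.cast_zero, sub_zero]

theorem windowSum_mono (hℓ : ∀ j, 0 ≤ ℓ j) {M : ℕ} (h : N ≤ M) (j : ℤ) :
    windowSum N ℓ j ≤ windowSum M ℓ j :=
  Finset.sum_le_sum_of_subset_of_nonneg (Finset.range_mono h) fun _ _ _ => hℓ _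

theorem windowSum_le {R : ℝ} {j : ℤ} (h : ∀ i ≤ j, ℓ i ≤ R) : windowSum N ℓ j ≤ N * R := by
  simpa [windowSum] using Finset.sum_le_card_nsmul (Finset.range N) (fun i : ℕ => ℓ (j - i)) R
    fun i _ => h _ (by omega)

theorem sum_range_shift_pow_le (hℓ : ∀ j, 0 ≤ ℓ j) (hneg : ∀ j < 0, ℓ j = 1) (q i k : ℕ) :
    ∑ j ∈ Finset.range k, ℓ (j - i) ^ q ≤ i + ∑ j ∈ Finset.range k, ℓ j ^ q := by
  induction i with
  | zero => simp
  | succ i ih =>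
    calc ∑ j ∈ Finset.range k, ℓ (j - (i + 1 : ℕ)) ^ q
        ≤ ∑ j ∈ Finset.range (k + 1), ℓ (j - (i + 1 : ℕ)) ^ q := by
          rw [Finset.sum_range_succ]
          exact le_add_of_nonneg_right (pow_nonneg (hℓ _) _)
      _ = ∑ j ∈ Finset.range k, ℓ (j - i) ^ q + 1 := by
          rw [Finset.sum_range_succ', hneg _ (by push_cast; omega), one_pow]
          simp only [Nat.cast_add, Nat.cast_one, add_sub_add_right_eq_sub]
      _ ≤ (i + 1 : ℕ) + ∑ j ∈ Finset.range k, ℓ j ^ q := by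
          push_cast
          linarith

theorem sum_windowSum_pow_le (hℓ : ∀ j, 0 ≤ ℓ j) (hneg : ∀ j < 0, ℓ j = 1) (q k : ℕ) :
    ∑ j ∈ Finset.range k, windowSum N ℓ j ^ (q + 1) ≤
      (N : ℝ) ^ (q + 1) * (N + ∑ j ∈ Finset.range k, ℓ j ^ (q + 1)) := by
  have hjensen : ∀ j : ℤ, windowSum N ℓ j ^ (q + 1) ≤
      (N : ℝ) ^ q * ∑ i ∈ Finset.range N, ℓ (j - i) ^ (q + 1) := fun j => by
    simpa [windowSum] using pow_sum_le_card_mul_sum_pow (s := Finset.range N)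
      (f := fun i : ℕ => ℓ (j - i)) (fun i _ => hℓ _) q
  have hshift : ∀ i ∈ Finset.range N, ∑ j ∈ Finset.range k, ℓ (j - i) ^ (q + 1) ≤
      N + ∑ j ∈ Finset.range k, ℓ j ^ (q + 1) := fun i hi => by
    have hiN : (i : ℝ) ≤ N := by exact_mod_cast (Finset.mem_range.1 hi).le
    linarith [sum_range_shift_pow_le hℓ hneg (q + 1) i k]
  calc ∑ j ∈ Finset.range k, windowSum N ℓ j ^ (q + 1)
      ≤ (N : ℝ) ^ q * ∑ i ∈ Finset.range N, ∑ j ∈ Finset.range k, ℓ (j - i) ^ (q + 1) := by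
        rw [Finset.sum_comm, Finset.mul_sum]
        exact Finset.sum_le_sum fun j _ => hjensen j
    _ ≤ (N : ℝ) ^ q * (N * (N + ∑ j ∈ Finset.range k, ℓ j ^ (q + 1))) := by
        gcongr
        exact (Finset.sum_le_card_nsmul _ _ _ hshift).trans_eq
          (by rw [Finset.card_range, nsmul_eq_mul])
    _ = _ := by rw [pow_succ, mul_assoc]

end Window

theorem pow_le_rpow_of_pow_le {w y : ℝ} {q : ℕ} (hw : 0 ≤ w) (hq : q ≠ 0) (h : w ^ q ≤ y)
    (r : ℕ) : w ^ r ≤ y ^ ((r : ℝ) / q) := by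
  calc w ^ r = (w ^ q) ^ ((r : ℝ) / q) := by
        rw [← Real.rpow_natCast w q, ← Real.rpow_mul hw,
          mul_div_cancel₀ _ (Nat.cast_ne_zero.2 hq), Real.rpow_natCast]
    _ ≤ y ^ ((r : ℝ) / q) := Real.rpow_le_rpow (by positivity) h (by positivity)

/-- The constants of the scalar recursion `ScalarRun`: the order `p` of the model, the length `N`
of the windows, the initial regularization `σ₀`, and the coefficients of its inequalities. -/
structure ScalarConstants where
  p : ℕ
  N : ℕ
  σ₀ : ℝ
  /-- the tolerance of the approximate minimization of the model -/
  θ : ℝ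
  /-- the tensor error relative to the window sum of step lengths -/
  E : ℝ
  /-- the lower bound on the derivatives of order at least three -/
  K : ℝ
  /-- the initial optimality gap -/
  Δ : ℝ
  /-- the initial gradient norm and negative curvature -/
  M : ℝ
  σ₀_pos : 0 < σ₀
  θ_nonneg : 0 ≤ θ
  E_nonneg : 0 ≤ E

/-- The relations between the step lengths `ℓ`, the regularization parameters `σ`, the gradient
norms `g` and the negative curvatures `c` along a run that suffice for the rate of convergence.
Step lengths are indexed by `ℤ` because windows reach back to indices before the first step. -/
structure ScalarRun (C : ScalarConstants) (ℓ : ℤ → ℝ) (σ g c : ℕ → ℝ) : Prop where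
  length_nonneg : ∀ j, 0 ≤ ℓ j
  length_of_neg : ∀ j < 0, ℓ j = 1
  σ_zero : σ 0 = C.σ₀
  σ_succ : ∀ k, σ (k + 1) = σ k + σ k * ℓ k ^ (C.p + 1)
  σ_le : ∀ k, σ k ≤ C.σ₀ + (C.p + 1)! *
    (C.Δ + C.E * ∑ j ∈ Finset.range k, windowSum C.N ℓ j ^ (C.p + 1))
  initial_le : g 0 + c 0 ≤ C.M
  gradient_le : ∀ k, g (k + 1) ≤ (C.θ * σ k + C.E) * windowSum C.N ℓ k ^ C.p
  curvature_le : ∀ k, c (k + 1) ≤ (C.θ * σ k + C.E) * windowSum C.N ℓ k ^ (C.p - 1)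
  step_le : ∀ k : ℕ, 1 ≤ ℓ k →
    σ k / (C.p + 1)! * ℓ k ≤ g k + c k + C.K + C.E * windowSum C.N ℓ (k - 1)

namespace ScalarRun

variable {C : ScalarConstants} {ℓ : ℤ → ℝ} {σ g c : ℕ → ℝ}

theorem σ₀_le (h : ScalarRun C ℓ σ g c) (k : ℕ) : C.σ₀ ≤ σ k := by
  induction k with
  | zero => exact h.σ_zero.ge
  | succ k ih =>
    rw [h.σ_succ]
    have := mul_nonneg (C.σ₀_pos.le.trans ih) (pow_nonneg (h.length_nonneg k) (C.p + 1))
    linarith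

theorem σ_nonneg (h : ScalarRun C ℓ σ g c) (k : ℕ) : 0 ≤ σ k :=
  C.σ₀_pos.le.trans (h.σ₀_le k)

theorem σ_le_σ_succ (h : ScalarRun C ℓ σ g c) (k : ℕ) : σ k ≤ σ (k + 1) := by
  rw [h.σ_succ]
  exact le_add_of_nonneg_right (mul_nonneg (h.σ_nonneg k) (pow_nonneg (h.length_nonneg k) _))

theorem sum_length_pow_le (h : ScalarRun C ℓ σ g c) (k : ℕ) :
    ∑ j ∈ Finset.range k, ℓ j ^ (C.p + 1) ≤ σ k / C.σ₀ := by
  rw [le_div_iff₀' C.σ₀_pos]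
  induction k with
  | zero => simpa using h.σ_nonneg 0
  | succ k ih =>
    have := mul_le_mul_of_nonneg_right (h.σ₀_le k) (pow_nonneg (h.length_nonneg k) (C.p + 1))
    rw [Finset.sum_range_succ, h.σ_succ]
    linarith

theorem length_le_max (h : ScalarRun C ℓ σ g c) {i : ℤ} {k : ℕ} (hi : i < k) :
    ℓ i ≤ max 1 (σ k / C.σ₀) := by
  rcases lt_or_ge i 0 with hi0 | hi0
  · exact (h.length_of_neg i hi0).trans_le (le_max_left _ _)
  · lift i to ℕ using hi0
    rcases le_total (ℓ i) 1 with hle | hge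
    · exact hle.trans (le_max_left _ _)
    · refine le_max_of_le_right ?_
      calc ℓ i ≤ ℓ i ^ (C.p + 1) := le_self_pow₀ hge C.p.succ_ne_zero
        _ ≤ ∑ j ∈ Finset.range k, ℓ j ^ (C.p + 1) :=
          Finset.single_le_sum (f := fun j : ℕ => ℓ j ^ (C.p + 1))
            (fun j _ => pow_nonneg (h.length_nonneg j) _) (Finset.mem_range.2 (by omega))
        _ ≤ σ k / C.σ₀ := h.sum_length_pow_le k

theorem windowSum_le_of_lt (h : ScalarRun C ℓ σ g c) {j : ℤ} {k : ℕ} (hj : j < k) {S : ℝ}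
    (hS : σ k ≤ S) : windowSum C.N ℓ j ≤ C.N * max 1 (S / C.σ₀) :=
  windowSum_le fun _ hi => (h.length_le_max (hi.trans_lt hj)).trans
    (max_le_max le_rfl (div_le_div_of_nonneg_right hS C.σ₀_pos.le))

theorem exists_gradient_add_curvature_le (C : ScalarConstants) (S : ℝ) :
    ∃ M : ℝ, ∀ {ℓ σ g c}, ScalarRun C ℓ σ g c → ∀ k, σ k ≤ S → g k + c k ≤ M := by
  set W : ℝ := C.N * max 1 (S / C.σ₀)
  refine ⟨max C.M ((C.θ * S + C.E) * W ^ C.p + (C.θ * S + C.E) * W ^ (C.p - 1)),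
    fun {ℓ σ g c} h k hk => ?_⟩
  cases k with
  | zero => exact le_max_of_le_left h.initial_le
  | succ k =>
    have hW : windowSum C.N ℓ k ≤ W := h.windowSum_le_of_lt (by push_cast; omega) hk
    have hW0 : 0 ≤ windowSum C.N ℓ k := windowSum_nonneg h.length_nonneg k
    have hσS : σ k ≤ S := (h.σ_le_σ_succ k).trans hk
    have hcoeff : C.θ * σ k + C.E ≤ C.θ * S + C.E := by gcongr; exact C.θ_nonneg
    have hcoeff0 : 0 ≤ C.θ * S + C.E :=
      add_nonneg (mul_nonneg C.θ_nonneg ((h.σ_nonneg k).trans hσS)) C.E_nonneg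
    refine le_max_of_le_right (add_le_add ((h.gradient_le k).trans ?_)
      ((h.curvature_le k).trans ?_)) <;> gcongr

theorem exists_length_le (C : ScalarConstants) (S : ℝ) :
    ∃ R : ℝ, 0 ≤ R ∧ ∀ {ℓ σ g c}, ScalarRun C ℓ σ g c → ∀ k, σ k ≤ S → ℓ k ≤ R := by
  obtain ⟨M, hM⟩ := exists_gradient_add_curvature_le C S
  set W : ℝ := C.N * max 1 (S / C.σ₀)
  refine ⟨max 1 ((M + C.K + C.E * W) / (C.σ₀ / (C.p + 1)!)), by positivity,
    fun {ℓ σ g c} h k hk => ?_⟩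
  rcases le_total (ℓ k) 1 with hle | hge
  · exact hle.trans (le_max_left _ _)
  · have hσ₀ := C.σ₀_pos
    refine le_max_of_le_right ((le_div_iff₀' (by positivity)).2 ?_)
    calc C.σ₀ / (C.p + 1)! * ℓ k ≤ σ k / (C.p + 1)! * ℓ k := by gcongr; exact h.σ₀_le k
      _ ≤ g k + c k + C.K + C.E * windowSum C.N ℓ (k - 1) := h.step_le k hge
      _ ≤ M + C.K + C.E * W := by
        gcongr
        · exact hM h k hk
        · exact C.E_nonneg
        · exact h.windowSum_le_of_lt (by omega) hk

theorem mul_sum_length_pow_le (h : ScalarRun C ℓ σ g c) {b R : ℝ} (hb : 0 ≤ b) (hR0 : 0 ≤ R)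
    (hR : ∀ k, σ k ≤ 2 * b → ℓ k ≤ R) (k : ℕ) :
    b * ∑ j ∈ Finset.range k, ℓ j ^ (C.p + 1) ≤
      b * (2 * b / C.σ₀ + R ^ (C.p + 1)) + σ k / 2 := by
  have hσ₀ := C.σ₀_pos
  induction k with
  | zero =>
    have := h.σ_nonneg 0
    simp only [Finset.range_zero, Finset.sum_empty, mul_zero]
    positivity
  | succ k ih =>
    have hpow := pow_nonneg (h.length_nonneg k) (C.p + 1)
    rcases le_total (σ k) (2 * b) with hsmall | hlarge
    · calc b * ∑ j ∈ Finset.range (k + 1), ℓ j ^ (C.p + 1)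
          ≤ b * (2 * b / C.σ₀ + R ^ (C.p + 1)) := by
            rw [Finset.sum_range_succ]
            have hsum := (h.sum_length_pow_le k).trans
              (div_le_div_of_nonneg_right hsmall hσ₀.le)
            gcongr
            · exact h.length_nonneg k
            · exact hR k hsmall
        _ ≤ _ := le_add_of_nonneg_right (half_pos (hσ₀.trans_le (h.σ₀_le _))).le
    · have := mul_le_mul_of_nonneg_right hlarge hpow
      rw [Finset.sum_range_succ, h.σ_succ]
      linarith

theorem exists_σ_le (C : ScalarConstants) :
    ∃ σmax : ℝ, ∀ {ℓ σ g c}, ScalarRun C ℓ σ g c → ∀ k, σ k ≤ σmax := by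
  have hE := C.E_nonneg
  set b : ℝ := (C.p + 1)! * (C.E * C.N ^ (C.p + 1))
  have hb : 0 ≤ b := by positivity
  obtain ⟨R, hR0, hR⟩ := exists_length_le C (2 * b)
  set X : ℝ := 2 * b / C.σ₀ + R ^ (C.p + 1)
  refine ⟨2 * (C.σ₀ + (C.p + 1)! * C.Δ + b * C.N + b * X), fun {ℓ σ g c} h k => ?_⟩
  have habsorb := h.mul_sum_length_pow_le hb hR0 (hR h) k
  have hgrowth : σ k ≤ C.σ₀ + (C.p + 1)! * C.Δ + b * C.N +
      b * ∑ j ∈ Finset.range k, ℓ j ^ (C.p + 1) :=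
    calc σ k ≤ C.σ₀ + (C.p + 1)! *
          (C.Δ + C.E * ∑ j ∈ Finset.range k, windowSum C.N ℓ j ^ (C.p + 1)) := h.σ_le k
      _ ≤ C.σ₀ + (C.p + 1)! * (C.Δ + C.E *
          (C.N ^ (C.p + 1) * (C.N + ∑ j ∈ Finset.range k, ℓ j ^ (C.p + 1)))) := by
        gcongr
        exact sum_windowSum_pow_le h.length_nonneg h.length_of_neg _ _
      _ = _ := by ring
  linarith

theorem exists_windowSum_pow_le (h : ScalarRun C ℓ σ g c) {σmax : ℝ} (hσ : ∀ k, σ k ≤ σmax)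
    (k : ℕ) : ∃ j ≤ k, windowSum C.N ℓ j ^ (C.p + 1) ≤
      C.N ^ (C.p + 1) * (C.N + σmax / C.σ₀) / (k + 1) := by
  suffices ∃ j ∈ Finset.range (k + 1), windowSum C.N ℓ j ^ (C.p + 1) ≤
      C.N ^ (C.p + 1) * (C.N + σmax / C.σ₀) / (k + 1) by
    simpa only [Finset.mem_range, Nat.lt_succ_iff] using this
  refine Finset.exists_le_of_sum_le (by simp) ?_
  calc ∑ j ∈ Finset.range (k + 1), windowSum C.N ℓ j ^ (C.p + 1)
      ≤ C.N ^ (C.p + 1) * (C.N + ∑ j ∈ Finset.range (k + 1), ℓ j ^ (C.p + 1)) :=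
        sum_windowSum_pow_le h.length_nonneg h.length_of_neg _ _
    _ ≤ C.N ^ (C.p + 1) * (C.N + σmax / C.σ₀) := by
        gcongr
        exact (h.sum_length_pow_le _).trans (div_le_div_of_nonneg_right (hσ _) C.σ₀_pos.le)
    _ = ∑ _j ∈ Finset.range (k + 1), C.N ^ (C.p + 1) * (C.N + σmax / C.σ₀) / (k + 1) := by
        rw [Finset.sum_const, Finset.card_range, nsmul_eq_mul, Nat.cast_succ,
          mul_div_cancel₀ _ (by positivity)]

theorem exists_rate (C : ScalarConstants) :
    ∃ C₁ C₂ : ℝ, ∀ {ℓ σ g c}, ScalarRun C ℓ σ g c → ∀ k : ℕ, ∃ j ≤ k,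
      g (j + 1) ≤ C₁ / ((k : ℝ) + 1) ^ ((C.p : ℝ) / (C.p + 1)) ∧
      c (j + 1) ≤ C₂ / ((k : ℝ) + 1) ^ (((C.p - 1 : ℕ) : ℝ) / (C.p + 1)) := by
  obtain ⟨σmax, hσmax⟩ := exists_σ_le C
  set V : ℝ := C.N ^ (C.p + 1) * (C.N + σmax / C.σ₀)
  refine ⟨(C.θ * σmax + C.E) * V ^ ((C.p : ℝ) / (C.p + 1)),
    (C.θ * σmax + C.E) * V ^ (((C.p - 1 : ℕ) : ℝ) / (C.p + 1)), fun {ℓ σ g c} h k => ?_⟩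
  have hσmax0 : 0 ≤ σmax := (h.σ_nonneg 0).trans (hσmax h 0)
  have hσ₀ := C.σ₀_pos
  have hV : 0 ≤ V := by positivity
  obtain ⟨j, hjk, hj⟩ := h.exists_windowSum_pow_le (hσmax h) k
  have hw : 0 ≤ windowSum C.N ℓ j := windowSum_nonneg h.length_nonneg j
  have hrate : ∀ r : ℕ, (C.θ * σ j + C.E) * windowSum C.N ℓ j ^ r ≤
      (C.θ * σmax + C.E) * V ^ ((r : ℝ) / (C.p + 1)) / ((k : ℝ) + 1) ^ ((r : ℝ) / (C.p + 1)) :=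
    fun r => by
      have hpow := pow_le_rpow_of_pow_le hw C.p.succ_ne_zero hj r
      rw [Real.div_rpow hV (by positivity), Nat.cast_succ] at hpow
      rw [mul_div_assoc]
      have := C.θ_nonneg
      have := C.E_nonneg
      gcongr
      exact hσmax h j
  exact ⟨j, hjk, (h.gradient_le j).trans (hrate _), (h.curvature_le j).trans (hrate _)⟩

end ScalarRun

section AveragedTensor

open scoped NNReal

variable {n p : ℕ} {f : Vec n → ℝ} {L : ℝ≥0}

theorem norm_averagedTensor_sub_le (hf : ContDiff ℝ p f)
    (hL : LipschitzWith L (iteratedFDeriv ℝ p f)) (x s : Vec n) {u : ℝ}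
    (hu : u ∈ Set.Icc (0 : ℝ) 1) :
    ‖averagedTensor p f x s - iteratedFDeriv ℝ p f (x + u • s)‖ ≤ L * ‖s‖ := by
  have hcont : Continuous fun t : ℝ => iteratedFDeriv ℝ p f (x + t • s) :=
    (hf.continuous_iteratedFDeriv le_rfl).comp (by fun_prop)
  have hconst : iteratedFDeriv ℝ p f (x + u • s) =
      ∫ _ in (0 : ℝ)..1, iteratedFDeriv ℝ p f (x + u • s) := by simp
  rw [averagedTensor, hconst, ← intervalIntegral.integral_sub (hcont.intervalIntegrable _ _)
    intervalIntegrable_const]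
  refine (intervalIntegral.norm_integral_le_of_norm_le_const (C := L * ‖s‖)
    fun t ht => ?_).trans_eq (by simp)
  rw [Set.uIoc_of_le zero_le_one] at ht
  have htu : |t - u| ≤ 1 := by
    rw [abs_le]
    constructor <;> linarith [ht.1, ht.2, hu.1, hu.2]
  refine (hL.norm_sub_le _ _).trans ?_
  rw [add_sub_add_left_eq_sub, ← sub_smul, norm_smul, Real.norm_eq_abs]
  exact mul_le_mul_of_nonneg_left (mul_le_of_le_one_left (norm_nonneg s) htu) L.coe_nonneg

theorem norm_averagedTensor_sub_left_le (hf : ContDiff ℝ p f)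
    (hL : LipschitzWith L (iteratedFDeriv ℝ p f)) (x s : Vec n) :
    ‖averagedTensor p f x s - iteratedFDeriv ℝ p f x‖ ≤ L * ‖s‖ := by
  simpa using norm_averagedTensor_sub_le hf hL x s (u := 0) (by simp)

theorem norm_averagedTensor_sub_right_le (hf : ContDiff ℝ p f)
    (hL : LipschitzWith L (iteratedFDeriv ℝ p f)) (x s : Vec n) :
    ‖averagedTensor p f x s - iteratedFDeriv ℝ p f (x + s)‖ ≤ L * ‖s‖ := by
  simpa using norm_averagedTensor_sub_le hf hL x s (u := 1) (by simp)

end AveragedTensor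

section StepLength

variable {n : ℕ}

theorem stepLength_nonneg (s : ℕ → Vec n) (j : ℤ) : 0 ≤ stepLength s j := by
  rw [stepLength]
  split_ifs <;> positivity

theorem stepLength_natCast (s : ℕ → Vec n) (k : ℕ) : stepLength s k = ‖s k‖ := by
  simp [stepLength]

theorem stepLength_of_neg (s : ℕ → Vec n) {j : ℤ} (hj : j < 0) : stepLength s j = 1 :=
  if_pos hj

theorem sum_Icc_sub_eq_windowSum (ℓ : ℤ → ℝ) (N : ℕ) (j : ℤ) :
    ∑ i ∈ Finset.Icc 1 N, ℓ (j - i) = windowSum N ℓ (j - 1) := by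
  rw [windowSum, ← Finset.Ico_add_one_right_eq_Icc, Finset.sum_Ico_eq_sum_range,
    Nat.add_sub_cancel]
  simp only [Nat.cast_add, Nat.cast_one, sub_sub]

theorem norm_le_windowSum_succ (s : ℕ → Vec n) (N k : ℕ) :
    ‖s k‖ ≤ windowSum (N + 1) (stepLength s) k := by
  rw [windowSum_succ, stepLength_natCast]
  exact le_add_of_nonneg_left (windowSum_nonneg (stepLength_nonneg s) _)

end StepLength

section LongStep

open scoped NNReal

variable {n p : ℕ} {f : Vec n → ℝ} {κ : ℝ≥0} {x d : Vec n}

theorem norm_gradient_eq_norm_iteratedFDeriv_one (f : Vec n → ℝ) (x : Vec n) :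
    ‖gradient f x‖ = ‖iteratedFDeriv ℝ 1 f x‖ := by
  rw [gradient, LinearIsometryEquiv.norm_map, norm_iteratedFDeriv_one]

theorem neg_iteratedFDeriv_one_le (f : Vec n → ℝ) (x d : Vec n) :
    -iteratedFDeriv ℝ 1 f x (fun _ => d) ≤ ‖gradient f x‖ * ‖d‖ := by
  rw [norm_gradient_eq_norm_iteratedFDeriv_one]
  simpa using neg_le.1 (neg_le_of_abs_le ((iteratedFDeriv ℝ 1 f x).le_opNorm fun _ => d))

theorem neg_apply_div_factorial_le (A : Tensor n p) (d : Vec n) :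
    -(A (fun _ => d) / (p ! : ℝ)) ≤ ‖A‖ * ‖d‖ ^ p := by
  have hA : |A (fun _ => d)| ≤ ‖A‖ * ‖d‖ ^ p := by simpa using A.le_opNorm fun _ => d
  calc -(A (fun _ => d) / (p ! : ℝ)) ≤ |A (fun _ => d)| / (p ! : ℝ) := by
        rw [← neg_div]
        gcongr
        exact neg_le_abs _
    _ ≤ |A (fun _ => d)| := div_le_self (abs_nonneg _) (by exact_mod_cast p.factorial_pos)
    _ ≤ ‖A‖ * ‖d‖ ^ p := hA

theorem approxTaylor_eq_add_sum_Icc (hp : p ≠ 0) (f : Vec n → ℝ) (x : Vec n) (T : Tensor n p)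
    (d : Vec n) :
    approxTaylor f x T d =
      f x + ∑ i ∈ Finset.Icc 1 p, (1 / (i ! : ℝ)) * iteratedFDeriv ℝ i f x (fun _ => d) +
        (T - iteratedFDeriv ℝ p f x) (fun _ => d) / (p ! : ℝ) := by
  obtain ⟨q, rfl⟩ := Nat.exists_eq_succ_of_ne_zero hp
  rw [approxTaylor, Finset.sum_Icc_succ_top (by omega), _root_.sub_apply, Nat.succ_sub_one]
  ring

theorem neg_sum_iteratedFDeriv_le (hf : ContDiff ℝ 2 f) (hp : 2 ≤ p)
    (hlow : ∀ i ∈ Finset.Icc 3 p, ∀ d : Vec n, ‖d‖ ≤ 1 →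
      -(κ : ℝ) ≤ iteratedFDeriv ℝ i f x (fun _ => d)) (hd : 1 ≤ ‖d‖) :
    -∑ i ∈ Finset.Icc 1 p, (1 / (i ! : ℝ)) * iteratedFDeriv ℝ i f x (fun _ => d) ≤
      (‖gradient f x‖ + negCurvature f x + p * κ) * ‖d‖ ^ p := by
  have hterm : ∀ (i : ℕ) {b : ℝ}, i ≤ p → 0 ≤ b →
      -iteratedFDeriv ℝ i f x (fun _ => d) ≤ b * ‖d‖ ^ i →
      -((1 / (i ! : ℝ)) * iteratedFDeriv ℝ i f x (fun _ => d)) ≤ b * ‖d‖ ^ p :=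
    fun i b hi hb h => by
      have hfact : 1 / (i ! : ℝ) ≤ 1 := by
        rw [one_div]
        exact inv_le_one_of_one_le₀ (by exact_mod_cast i.factorial_pos)
      calc -((1 / (i ! : ℝ)) * iteratedFDeriv ℝ i f x (fun _ => d))
          ≤ 1 / (i ! : ℝ) * (b * ‖d‖ ^ i) := by
            rw [← mul_neg]
            gcongr
        _ ≤ b * ‖d‖ ^ i := mul_le_of_le_one_left (by positivity) hfact
        _ ≤ b * ‖d‖ ^ p := by gcongr
  have hone := hterm 1 (by omega) (norm_nonneg _)
    (by simpa only [pow_one] using neg_iteratedFDeriv_one_le f x d)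
  have htwo := hterm 2 hp (negCurvature_nonneg f x) (neg_iteratedFDeriv_two_le hf x d)
  have hhigh : ∑ i ∈ Finset.Icc 3 p, -((1 / (i ! : ℝ)) * iteratedFDeriv ℝ i f x (fun _ => d)) ≤
      p * (κ * ‖d‖ ^ p) := by
    refine (Finset.sum_le_card_nsmul _ _ _ fun i hi =>
      hterm i (Finset.mem_Icc.1 hi).2 κ.coe_nonneg ?_).trans ?_
    · linarith [neg_mul_norm_pow_le_apply_diagonal (hlow i hi) d]
    · rw [nsmul_eq_mul, Nat.card_Icc]
      gcongr
      omega
  have hsplit : Finset.Icc 1 p = insert 1 (insert 2 (Finset.Icc 3 p)) := by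
    ext i
    simp only [Finset.mem_insert, Finset.mem_Icc]
    omega
  rw [← Finset.sum_neg_distrib, hsplit, Finset.sum_insert (by simp), Finset.sum_insert (by simp)]
  linarith

end LongStep

namespace Params

open scoped NNReal

/-- The constant bounding the error of the approximate tensors, and of the Taylor models built
from them, by the window sums of step lengths. -/
noncomputable def errorCoeff (P : Params) (L : ℝ≥0) : ℝ :=
  P.κC ^ P.m * (P.κA + 2 * L) + L

theorem errorCoeff_nonneg (P : Params) (L : ℝ≥0) : 0 ≤ P.errorCoeff L := by
  have hκA := P.κA_nonneg
  have hκC := P.one_le_κC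
  unfold errorCoeff
  positivity

/-- The constants of the scalar recursion satisfied by every run with parameters `P`. -/
noncomputable def scalarConstants (P : Params) (p : ℕ) (L κ : ℝ≥0) (Δ G B : ℝ) :
    ScalarConstants where
  p := p
  N := 2 * P.m + 1
  σ₀ := P.σ₀
  θ := max P.θ₁ P.θ₂
  E := P.errorCoeff L
  K := p * κ
  Δ := Δ
  M := G + B
  σ₀_pos := P.σ₀_pos
  θ_nonneg := le_max_of_le_left (zero_le_one.trans P.one_lt_θ₁.le)
  E_nonneg := P.errorCoeff_nonneg L

end Params

namespace IsRun

open scoped NNReal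

variable {n p : ℕ} {P : Params} {f : Vec n → ℝ} {x₀ : Vec n} {x s : ℕ → Vec n} {σ : ℕ → ℝ}
  {T : ℕ → Tensor n p} {L : ℝ≥0}

theorem norm_tensor_sub_le_of_dvd (h : IsRun P f x₀ x s σ T) {k : ℕ} (hk : P.m ∣ k) :
    ‖T k - iteratedFDeriv ℝ p f (x k)‖ ≤ P.κA * windowSum P.m (stepLength s) (k - 1) := by
  rw [← sum_Icc_sub_eq_windowSum]
  exact (h.tensor_restart k (Nat.mod_eq_zero_of_dvd hk)).trans (min_le_left _ _)

theorem norm_tensor_succ_sub_le (h : IsRun P f x₀ x s σ T) (hf : ContDiff ℝ p f)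
    (hL : LipschitzWith L (iteratedFDeriv ℝ p f)) {k : ℕ} (hk : ¬P.m ∣ k + 1) :
    ‖T (k + 1) - iteratedFDeriv ℝ p f (x (k + 1))‖ ≤
      P.κC * (‖T k - iteratedFDeriv ℝ p f (x k)‖ + 2 * (L * ‖s k‖)) := by
  have hκC := P.one_le_κC
  have hleft := norm_averagedTensor_sub_left_le hf hL (x k) (s k)
  have hright := norm_averagedTensor_sub_right_le hf hL (x k) (s k)
  rw [norm_sub_rev] at hleft
  rw [← h.x_succ] at hright
  set A := averagedTensor p f (x k) (s k)
  calc ‖T (k + 1) - iteratedFDeriv ℝ p f (x (k + 1))‖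
      ≤ ‖T (k + 1) - A‖ + ‖A - iteratedFDeriv ℝ p f (x (k + 1))‖ :=
        norm_sub_le_norm_sub_add_norm_sub _ _ _
    _ ≤ P.κC * ‖T k - A‖ + P.κC * (L * ‖s k‖) :=
        add_le_add (h.tensor_update k (mt Nat.dvd_of_mod_eq_zero hk))
          (hright.trans (le_mul_of_one_le_left (by positivity) hκC))
    _ ≤ P.κC * (‖T k - iteratedFDeriv ℝ p f (x k)‖ + L * ‖s k‖) + P.κC * (L * ‖s k‖) := by
        gcongr
        exact (norm_sub_le_norm_sub_add_norm_sub _ _ _).trans (add_le_add le_rfl hleft)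
    _ = _ := by ring

theorem norm_tensor_mul_add_sub_le (h : IsRun P f x₀ x s σ T) (hf : ContDiff ℝ p f)
    (hL : LipschitzWith L (iteratedFDeriv ℝ p f)) (a : ℕ) {r : ℕ} (hr : r < P.m) :
    ‖T (P.m * a + r) - iteratedFDeriv ℝ p f (x (P.m * a + r))‖ ≤
      P.κC ^ r * ((P.κA + 2 * L) *
        windowSum (P.m + r) (stepLength s) ((P.m * a + r : ℕ) - 1)) := by
  have hκA := P.κA_nonneg
  have hκC := P.one_le_κC
  have hW := fun N j => windowSum_nonneg (N := N) (stepLength_nonneg s) j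
  induction r with
  | zero =>
    rw [pow_zero, one_mul, add_zero, add_zero]
    refine (h.norm_tensor_sub_le_of_dvd (dvd_mul_right _ _)).trans ?_
    gcongr
    · exact hW _ _
    · exact le_add_of_nonneg_right (by positivity)
  | succ r ih =>
    have hndvd : ¬P.m ∣ P.m * a + r + 1 := by
      rw [add_assoc, Nat.dvd_add_right (dvd_mul_right _ _)]
      exact Nat.not_dvd_of_pos_of_lt r.succ_pos hr
    have hstep : 2 * (L * ‖s (P.m * a + r)‖) ≤
        P.κC ^ r * ((P.κA + 2 * L) * ‖s (P.m * a + r)‖) := by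
      rw [← mul_assoc]
      refine le_trans ?_ (le_mul_of_one_le_left (by positivity) (one_le_pow₀ hκC))
      gcongr
      exact le_add_of_nonneg_left hκA
    calc ‖T (P.m * a + r + 1) - iteratedFDeriv ℝ p f (x (P.m * a + r + 1))‖
        ≤ P.κC * (‖T (P.m * a + r) - iteratedFDeriv ℝ p f (x (P.m * a + r))‖ +
            2 * (L * ‖s (P.m * a + r)‖)) := h.norm_tensor_succ_sub_le hf hL hndvd
      _ ≤ P.κC * (P.κC ^ r * ((P.κA + 2 * L) *
            windowSum (P.m + r) (stepLength s) ((P.m * a + r : ℕ) - 1)) +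
            P.κC ^ r * ((P.κA + 2 * L) * ‖s (P.m * a + r)‖)) := by
          gcongr
          exact ih (Nat.lt_of_succ_lt hr)
      _ = _ := by
          rw [← add_assoc, ← add_assoc, Nat.cast_succ, add_sub_cancel_right, windowSum_succ,
            stepLength_natCast]
          ring

theorem norm_tensor_sub_le (h : IsRun P f x₀ x s σ T) (hf : ContDiff ℝ p f)
    (hL : LipschitzWith L (iteratedFDeriv ℝ p f)) (k : ℕ) :
    ‖T k - iteratedFDeriv ℝ p f (x k)‖ ≤
      P.κC ^ P.m * (P.κA + 2 * L) * windowSum (2 * P.m) (stepLength s) (k - 1) := by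
  have hκA := P.κA_nonneg
  have hκC := P.one_le_κC
  have hlt : k % P.m < P.m := Nat.mod_lt k P.one_le_m
  have hblock := h.norm_tensor_mul_add_sub_le hf hL (k / P.m) hlt
  rw [Nat.div_add_mod] at hblock
  rw [mul_assoc]
  refine hblock.trans ?_
  gcongr
  · exact mul_nonneg (by positivity) (windowSum_nonneg (stepLength_nonneg s) _)
  · exact windowSum_mono (stepLength_nonneg s) (by omega) _

theorem norm_tensor_sub_add_le (h : IsRun P f x₀ x s σ T) (hf : ContDiff ℝ p f)
    (hL : LipschitzWith L (iteratedFDeriv ℝ p f)) (k : ℕ) :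
    ‖T k - iteratedFDeriv ℝ p f (x k)‖ + L * ‖s k‖ ≤
      P.errorCoeff L * windowSum (2 * P.m + 1) (stepLength s) k := by
  have hκA := P.κA_nonneg
  have hκC := P.one_le_κC
  have hW := windowSum_nonneg (N := 2 * P.m) (stepLength_nonneg s) (k - 1)
  have hcross : 0 ≤ P.κC ^ P.m * (P.κA + 2 * L) * ‖s k‖ := by positivity
  have hcross' : 0 ≤ L * windowSum (2 * P.m) (stepLength s) (k - 1) := by positivity
  rw [windowSum_succ, stepLength_natCast, Params.errorCoeff]
  linarith [h.norm_tensor_sub_le hf hL k]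

theorem norm_tensor_sub_le_errorCoeff (h : IsRun P f x₀ x s σ T) (hf : ContDiff ℝ p f)
    (hL : LipschitzWith L (iteratedFDeriv ℝ p f)) (k : ℕ) :
    ‖T k - iteratedFDeriv ℝ p f (x k)‖ ≤
      P.errorCoeff L * windowSum (2 * P.m + 1) (stepLength s) (k - 1) := by
  exact (h.norm_tensor_sub_le hf hL k).trans (mul_le_mul (le_add_of_nonneg_right L.coe_nonneg)
    (windowSum_mono (stepLength_nonneg s) (Nat.le_succ _) _)
    (windowSum_nonneg (stepLength_nonneg s) _) (P.errorCoeff_nonneg L))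

theorem norm_iteratedFDeriv_succ_sub_approxTaylor_le (h : IsRun P f x₀ x s σ T)
    (hf : ContDiff ℝ p f) (hp : p ≠ 0) (hL : LipschitzWith L (iteratedFDeriv ℝ p f)) (k : ℕ)
    {i : ℕ} (hi : i ≤ p) :
    ‖iteratedFDeriv ℝ i f (x (k + 1)) -
        iteratedFDeriv ℝ i (approxTaylor f (x k) (T k)) (s k)‖ ≤
      P.errorCoeff L * windowSum (2 * P.m + 1) (stepLength s) k ^ (p + 1 - i) := by
  have hW := windowSum_nonneg (N := 2 * P.m + 1) (stepLength_nonneg s) k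
  have hE := P.errorCoeff_nonneg L
  rw [h.x_succ, Nat.succ_sub hi, pow_succ', ← mul_assoc]
  refine (norm_iteratedFDeriv_add_sub_approxTaylor_le hf hp hL _ _ _ hi).trans ?_
  gcongr
  · exact h.norm_tensor_sub_add_le hf hL k
  · exact norm_le_windowSum_succ s _ k

theorem σ_nonneg (h : IsRun P f x₀ x s σ T) (k : ℕ) : 0 ≤ σ k := by
  induction k with
  | zero => exact h.σ_zero.symm ▸ P.σ₀_pos.le
  | succ k ih =>
    rw [h.σ_succ]
    positivity

theorem approxTaylor_add_le (h : IsRun P f x₀ x s σ T) (hp : p ≠ 0) (k : ℕ) :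
    approxTaylor f (x k) (T k) (s k) + σ k / (p + 1)! * ‖s k‖ ^ (p + 1) ≤ f (x k) := by
  simpa [model, approxTaylor_zero hp] using h.step_decrease k

theorem σ_succ_sub_le (h : IsRun P f x₀ x s σ T) (hf : ContDiff ℝ p f) (hp : p ≠ 0)
    (hL : LipschitzWith L (iteratedFDeriv ℝ p f)) (k : ℕ) :
    σ (k + 1) - σ k ≤ (p + 1)! * (f (x k) - f (x (k + 1)) +
      P.errorCoeff L * windowSum (2 * P.m + 1) (stepLength s) k ^ (p + 1)) := by
  have htaylor := h.norm_iteratedFDeriv_succ_sub_approxTaylor_le hf hp hL k (Nat.zero_le p)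
  have hmodel := h.approxTaylor_add_le hp k
  have hdecrease : σ k / (p + 1)! * ‖s k‖ ^ (p + 1) ≤ f (x k) - f (x (k + 1)) +
      P.errorCoeff L * windowSum (2 * P.m + 1) (stepLength s) k ^ (p + 1) := by
    have hvalue : f (x (k + 1)) - approxTaylor f (x k) (T k) (s k) ≤
        P.errorCoeff L * windowSum (2 * P.m + 1) (stepLength s) k ^ (p + 1) := by
      have happly := (ContinuousMultilinearMap.le_opNorm _ ![]).trans
        (mul_le_mul_of_nonneg_right htaylor (by simp))
      simpa using (le_abs_self _).trans happly
    linarith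
  rw [h.σ_succ, add_sub_cancel_left, ← div_le_iff₀' (by positivity)]
  exact (div_mul_eq_mul_div _ _ _).symm.trans_le hdecrease

theorem σ_le (h : IsRun P f x₀ x s σ T) (hf : ContDiff ℝ p f) (hp : p ≠ 0)
    (hL : LipschitzWith L (iteratedFDeriv ℝ p f)) {fLow Δ : ℝ} (hlow : BoundedBelowBy f fLow)
    (hΔ : f x₀ - fLow ≤ Δ) (k : ℕ) :
    σ k ≤ P.σ₀ + (p + 1)! * (Δ + P.errorCoeff L *
      ∑ j ∈ Finset.range k, windowSum (2 * P.m + 1) (stepLength s) j ^ (p + 1)) := by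
  have hsum := Finset.sum_le_sum fun j (_ : j ∈ Finset.range k) => h.σ_succ_sub_le hf hp hL j
  rw [Finset.sum_range_sub, ← Finset.mul_sum, Finset.sum_add_distrib, Finset.sum_range_sub',
    ← Finset.mul_sum, h.σ_zero, h.x_zero, sub_le_iff_le_add'] at hsum
  refine hsum.trans ?_
  gcongr
  linarith [hlow (x k)]

theorem norm_gradient_succ_le (h : IsRun P f x₀ x s σ T) (hf : ContDiff ℝ p f) (hp : p ≠ 0)
    (hL : LipschitzWith L (iteratedFDeriv ℝ p f)) (k : ℕ) :
    ‖gradient f (x (k + 1))‖ ≤ (P.θ₁ * σ k + P.errorCoeff L) *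
      windowSum (2 * P.m + 1) (stepLength s) k ^ p := by
  have hθ := zero_le_one.trans P.one_lt_θ₁.le
  have hσ := h.σ_nonneg k
  have herror := h.norm_iteratedFDeriv_succ_sub_approxTaylor_le hf hp hL k
    (Nat.one_le_iff_ne_zero.2 hp)
  rw [Nat.add_sub_cancel] at herror
  have hstep : ‖gradient (approxTaylor f (x k) (T k)) (s k)‖ ≤
      P.θ₁ * σ k * windowSum (2 * P.m + 1) (stepLength s) k ^ p := by
    refine (h.step_gradient k).trans ((div_le_self (by positivity)
      (by exact_mod_cast p.factorial_pos)).trans ?_)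
    gcongr
    exact norm_le_windowSum_succ s _ k
  rw [norm_gradient_eq_norm_iteratedFDeriv_one] at hstep ⊢
  rw [add_mul]
  exact (norm_le_norm_add_norm_sub' _ _).trans (add_le_add hstep herror)

theorem negCurvature_succ_le (h : IsRun P f x₀ x s σ T) (hf : ContDiff ℝ p f) (hp : 2 ≤ p)
    (hL : LipschitzWith L (iteratedFDeriv ℝ p f)) (k : ℕ) :
    negCurvature f (x (k + 1)) ≤ (P.θ₂ * σ k + P.errorCoeff L) *
      windowSum (2 * P.m + 1) (stepLength s) k ^ (p - 1) := by
  have hθ := zero_le_one.trans P.one_lt_θ₂.le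
  have hσ := h.σ_nonneg k
  have herror := h.norm_iteratedFDeriv_succ_sub_approxTaylor_le hf (by omega) hL k hp
  rw [show p + 1 - 2 = p - 1 by omega] at herror
  have hstep : negCurvature (approxTaylor f (x k) (T k)) (s k) ≤
      P.θ₂ * σ k * windowSum (2 * P.m + 1) (stepLength s) k ^ (p - 1) := by
    refine (h.step_curvature k).trans ((div_le_self (by positivity)
      (by exact_mod_cast (p - 1).factorial_pos)).trans ?_)
    gcongr
    exact norm_le_windowSum_succ s _ k
  rw [add_mul]
  exact (negCurvature_le_add_norm (hf.of_le (by exact_mod_cast hp))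
    (contDiff_approxTaylor f (x k) (T k)) _ _).trans (add_le_add hstep herror)

theorem mul_norm_step_le (h : IsRun P f x₀ x s σ T) (hf : ContDiff ℝ p f) (hp : 2 ≤ p)
    (hL : LipschitzWith L (iteratedFDeriv ℝ p f)) {κ : ℝ≥0}
    (hlow : ∀ i ∈ Finset.Icc 3 p, ∀ y d : Vec n, ‖d‖ ≤ 1 →
      -(κ : ℝ) ≤ iteratedFDeriv ℝ i f y (fun _ => d)) {k : ℕ} (hk : 1 ≤ ‖s k‖) :
    σ k / (p + 1)! * ‖s k‖ ≤ ‖gradient f (x k)‖ + negCurvature f (x k) + p * κ +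
      P.errorCoeff L * windowSum (2 * P.m + 1) (stepLength s) (k - 1) := by
  have hlong := neg_sum_iteratedFDeriv_le (hf.of_le (by exact_mod_cast hp)) hp
    (fun i hi => hlow i hi (x k)) hk
  have hmodel := h.approxTaylor_add_le (by omega) k
  have herror : -((T k - iteratedFDeriv ℝ p f (x k)) (fun _ => s k) / (p ! : ℝ)) ≤
      P.errorCoeff L * windowSum (2 * P.m + 1) (stepLength s) (k - 1) * ‖s k‖ ^ p := by
    refine (neg_apply_div_factorial_le _ _).trans ?_
    gcongr
    exact h.norm_tensor_sub_le_errorCoeff hf hL k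
  rw [approxTaylor_eq_add_sum_Icc (by omega)] at hmodel
  refine le_of_mul_le_mul_right ?_ (pow_pos (zero_lt_one.trans_le hk) p)
  rw [mul_assoc, ← pow_succ']
  linarith

theorem scalarRun (h : IsRun P f x₀ x s σ T) (hf : ContDiff ℝ p f) (hp : 2 ≤ p)
    (hL : LipschitzWith L (iteratedFDeriv ℝ p f)) {κ : ℝ≥0}
    (hderiv : ∀ i ∈ Finset.Icc 3 p, ∀ y d : Vec n, ‖d‖ ≤ 1 →
      -(κ : ℝ) ≤ iteratedFDeriv ℝ i f y (fun _ => d))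
    {fLow Δ G B : ℝ} (hlow : BoundedBelowBy f fLow) (hΔ : f x₀ - fLow ≤ Δ)
    (hG : ‖gradient f x₀‖ ≤ G) (hB : negCurvature f x₀ ≤ B) :
    ScalarRun (P.scalarConstants p L κ Δ G B) (stepLength s) σ
      (fun k => ‖gradient f (x k)‖) (fun k => negCurvature f (x k)) where
  length_nonneg := stepLength_nonneg s
  length_of_neg _ hj := stepLength_of_neg s hj
  σ_zero := h.σ_zero
  σ_succ k := by
    rw [stepLength_natCast]
    exact h.σ_succ k
  σ_le := h.σ_le hf (by omega) hL hlow hΔ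
  initial_le := by
    rw [h.x_zero]
    exact add_le_add hG hB
  gradient_le k := by
    refine (h.norm_gradient_succ_le hf (by omega) hL k).trans ?_
    exact mul_le_mul_of_nonneg_right (add_le_add_left (mul_le_mul_of_nonneg_right
      (le_max_left _ _) (h.σ_nonneg k)) _)
      (pow_nonneg (windowSum_nonneg (stepLength_nonneg s) _) _)
  curvature_le k := by
    refine (h.negCurvature_succ_le hf hp hL k).trans ?_
    exact mul_le_mul_of_nonneg_right (add_le_add_left (mul_le_mul_of_nonneg_right
      (le_max_right _ _) (h.σ_nonneg k)) _)
      (pow_nonneg (windowSum_nonneg (stepLength_nonneg s) _) _)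
  step_le k hk := by
    rw [stepLength_natCast] at hk ⊢
    exact h.mul_norm_step_le hf hp hL hderiv hk

end IsRun

section Conversions

variable {n p : ℕ} {f : Vec n → ℝ}

theorem LipschitzTensor.lipschitzWith {L : ℝ} (hL : LipschitzTensor p f L) :
    LipschitzWith L.toNNReal (iteratedFDeriv ℝ p f) :=
  LipschitzWith.of_dist_le' fun x y => by
    simpa only [dist_eq_norm] using hL.2 x y

theorem neg_norm_le_apply_diagonal (A : Tensor n p) {d : Vec n} (hd : ‖d‖ ≤ 1) :
    -‖A‖ ≤ A (fun _ => d) := by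
  refine (abs_le.1 ((A.le_opNorm fun _ => d).trans ?_)).1
  rw [Finset.prod_const]
  exact mul_le_of_le_one_right (norm_nonneg A) (pow_le_one₀ (norm_nonneg d) hd)

theorem minUpTo_le {a : ℕ → ℝ} {j k : ℕ} (hj : j ∈ Finset.Icc 1 (k + 1)) : minUpTo a k ≤ a j :=
  Finset.inf'_le a hj

end Conversions

end ARpApprox

open scoped NNReal in
theorem mainTheorem7_general {p : ℕ} (hp : 2 ≤ p) (P : ARpApprox.Params) (L κ : ℝ≥0)
    (Δ G B : ℝ) :
    ∃ C₁ C₂ : ℝ,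
      ∀ (n : ℕ) (f : ARpApprox.Vec n → ℝ) (fLow : ℝ) (x₀ : ARpApprox.Vec n),
        ContDiff ℝ p f →
        ARpApprox.BoundedBelowBy f fLow →
        LipschitzWith L (iteratedFDeriv ℝ p f) →
        (∀ i ∈ Finset.Icc 3 p, ∀ x d : ARpApprox.Vec n, ‖d‖ ≤ 1 →
          -(κ : ℝ) ≤ iteratedFDeriv ℝ i f x (fun _ => d)) →
        f x₀ - fLow ≤ Δ →
        ‖gradient f x₀‖ ≤ G →
        ARpApprox.negCurvature f x₀ ≤ B →
        ∀ (x s : ℕ → ARpApprox.Vec n) (σ : ℕ → ℝ) (T : ℕ → ARpApprox.Tensor n p),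
          ARpApprox.IsRun P f x₀ x s σ T →
          ∀ k : ℕ, ∃ j ∈ Finset.Icc 1 (k + 1),
            ‖gradient f (x j)‖ ≤ C₁ / ((k : ℝ) + 1) ^ ((p : ℝ) / (p + 1)) ∧
            ARpApprox.negCurvature f (x j) ≤
              C₂ / ((k : ℝ) + 1) ^ (((p : ℝ) - 1) / (p + 1)) := by
  obtain ⟨C₁, C₂, hrate⟩ :=
    ARpApprox.ScalarRun.exists_rate (P.scalarConstants p L κ Δ G B)
  refine ⟨C₁, C₂, fun n f fLow x₀ hf hlow hL hderiv hΔ hG hB x s σ T hrun k => ?_⟩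
  obtain ⟨j, hjk, hgrad, hcurv⟩ := hrate (hrun.scalarRun hf hp hL hderiv hlow hΔ hG hB) k
  refine ⟨j + 1, Finset.mem_Icc.2 ⟨Nat.le_add_left 1 j, Nat.succ_le_succ hjk⟩, hgrad, ?_⟩
  rw [← Nat.cast_pred (by omega : 0 < p)]
  exact hcurv

theorem mainTheorem7 (P : ARpApprox.Params) (L κ₃ Δ G B : ℝ) :
    ∃ C₁ C₂ : ℝ,
      ∀ (n : ℕ) (f : ARpApprox.Vec n → ℝ) (fLow : ℝ) (x₀ : ARpApprox.Vec n),
        ARpApprox.SmoothObjective 3 f →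
        ARpApprox.BoundedBelowBy f fLow →
        ARpApprox.LipschitzTensor 3 f L →
        ARpApprox.IntermediateBoundedBelow 3 f →
        ARpApprox.BoundedTensor 3 f κ₃ →
        f x₀ - fLow ≤ Δ →
        ‖gradient f x₀‖ ≤ G →
        ARpApprox.negCurvature f x₀ ≤ B →
        ∀ (x s : ℕ → ARpApprox.Vec n) (σ : ℕ → ℝ) (T : ℕ → ARpApprox.Tensor n 3),
          ARpApprox.IsRun P f x₀ x s σ T →
          ∀ k : ℕ,
            ARpApprox.minUpTo (fun j => ‖gradient f (x j)‖) k ≤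
              C₁ / ((k : ℝ) + 1) ^ (3 / 4 : ℝ) ∧
            ARpApprox.minUpTo (fun j => ARpApprox.negCurvature f (x j)) k ≤
              C₂ / ((k : ℝ) + 1) ^ (1 / 2 : ℝ) := by
  obtain ⟨C₁, C₂, hrate⟩ :=
    mainTheorem7_general (p := 3) (by norm_num) P L.toNNReal κ₃.toNNReal Δ G B
  refine ⟨C₁, C₂, fun n f fLow x₀ hf hlow hL _ hκ hΔ hG hB x s σ T hrun k => ?_⟩
  have hderiv : ∀ i ∈ Finset.Icc 3 3, ∀ y d : ARpApprox.Vec n, ‖d‖ ≤ 1 →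
      -(κ₃.toNNReal : ℝ) ≤ iteratedFDeriv ℝ i f y (fun _ => d) := fun i hi y d hd => by
    obtain rfl : i = 3 := by simpa using hi
    exact (neg_le_neg ((hκ le_rfl y).trans (Real.le_coe_toNNReal κ₃))).trans
      (ARpApprox.neg_norm_le_apply_diagonal _ hd)
  obtain ⟨j, hj, hgrad, hcurv⟩ :=
    hrate n f fLow x₀ hf.2 hlow hL.lipschitzWith hderiv hΔ hG hB x s σ T hrun k
  have hgradExp : ((3 : ℕ) : ℝ) / ((3 : ℕ) + 1) = 3 / 4 := by norm_num
  have hcurvExp : (((3 : ℕ) : ℝ) - 1) / ((3 : ℕ) + 1) = 1 / 2 := by norm_num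
  rw [hgradExp] at hgrad
  rw [hcurvExp] at hcurv
  exact ⟨(ARpApprox.minUpTo_le hj).trans hgrad, (ARpApprox.minUpTo_le hj).trans hcurv⟩
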